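/- All graphs and digraphs are finite, have at least one vertex, and have no loops or multiple edges (arcs); classes are closed under isomorphism. Let $\bullet$ be the one-vertex (di)graph. For vertex-disjoint (di)graphs $G_1,G_2$, $G_1\oplus G_2$ is the disjoint union. For graphs, the join $G_1\otimes G_2$ is the disjoint union together with all edges between $V(G_1)$ and $V(G_2)$. For digraphs, the order composition $G_1\oslash G_2$ is the disjoint union together with all arcs $(u,v)$, $u\in V(G_1)$, $v\in V(G_2)$. The following classes are defined recursively; each is the smallest class that contains $\bullet$ and is closed under the listed operations. - Oriented threshold graphs: $G\oplus\bullet$, $G\oslash\bullet$, $\bullet\oslash G$. - Oriented co-trivially perfect graphs: $G\oslash\bullet$, $\bullet\oslash G$, $G\oplus\bullet$. - Threshold graphs (undirected): $G\oplus\bullet$, $G\otimes\bullet$. - Co-trivially perfect graphs (undirected): $G\oplus\bullet$, $G_1\otimes G_2$. - Co-graphs (undirected): $G_1\oplus G_2$, $G_1\otimes G_2$. $\mathrm{Free}(F)$ is the set of all (di)graphs no induced sub(di)graph of which is isomorphic to a member of $F$, and $un(G)$ is the underlying undirected graph of a digraph $G$. A digraph is transitive if for all arcs $(u,v),(v,w)$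 with $u\ne w$ the arc $(u,w)$ is present. Let $D_1$ be the directed path on three vertices with arcs $(a,b),(b,c)$; $D_5$ the directed cycle on three vertices; $D_8$ the digraph on $a,b,c,d$ with arcs $(a,b),(c,b),(c,d)$ (the transitive orientation of $P_4$); $D_{12}$ the digraph on $a,b,c,d$ with arcs $(a,c),(a,d),(b,c),(b,d)$ (the transitive orientation of $C_4$); $2\overrightarrow{P_2}$ the disjoint union of two single arcs; $\overleftrightarrow{K_2}$ the digraph on two vertices with both arcs between them. $P_4$, $C_4$ and $2K_2$ are the path on four vertices, the cycle on four vertices, and two disjoint edges. **Theorem.** Let $G$ be a digraph. The following properties are equivalent: 1. $G$ is an oriented threshold graph. 2. $G$ is an oriented co-trivially perfect graph. 3. $G\in \mathrm{Free}(\{D_1,D_5,D_8,D_{12},2\overrightarrow{P_2},\overleftrightarrow{K_2}\})$. 4. $G\in \mathrm{Free}(\{D_1,D_5,\overleftrightarrow{K_2}\})$ and $un(G)\in \mathrm{Free}(\{2K_2,C_4,P_4\})$. 5. $G\in \mathrm{Free}(\{D_1,D_5,\overleftrightarrow{K_2}\})$ and $un(G)$ is a threshold graph. 6. $G\in \mathrm{Free}(\{D_1,D_5,D_{12},\overleftrightarrow{K_2}\})$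 and $un(G)\in \mathrm{Free}(\{P_4,2K_2\})$. 7. $G\in \mathrm{Free}(\{D_1,D_5,D_{12},\overleftrightarrow{K_2}\})$ and $un(G)$ is a co-trivially perfect graph. 8. $G\in \mathrm{Free}(\{D_1,D_5,D_{12},2\overrightarrow{P_2},\overleftrightarrow{K_2}\})$ and $un(G)\in \mathrm{Free}(\{P_4\})$. 9. $G\in \mathrm{Free}(\{D_1,D_5,D_{12},2\overrightarrow{P_2},\overleftrightarrow{K_2}\})$ and $un(G)$ is a co-graph. 10. $G$ is transitive and $G\in \mathrm{Free}(\{D_8,D_{12},2\overrightarrow{P_2},\overleftrightarrow{K_2}\})$. -/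

import Mathlib

universe u

namespace DiCograph

/-! ### Digraph operations

Digraphs are Mathlib's `Digraph V`, which allow loops; every digraph built below is loopless, and
the main statement assumes looplessness of the given digraph. -/

/-- The one-vertex digraph without arcs, `•`. -/
def bullet : Digraph PUnit.{u + 1} where
  Adj _ _ := False

/-- Disjoint union `G ⊕ H` of digraphs. -/
def disjUnion {V W : Type u} (G : Digraph V) (H : Digraph W) : Digraph (V ⊕ W) where
  Adj
    | .inl a, .inl b => G.Adj a b
    | .inr a, .inr b => H.Adj a b
    | _, _ => False

/-- Order composition `G ⊘ H`: disjoint union plus all arcs from `G` to `H`. -/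
def orderComp {V W : Type u} (G : Digraph V) (H : Digraph W) : Digraph (V ⊕ W) where
  Adj
    | .inl a, .inl b => G.Adj a b
    | .inr a, .inr b => H.Adj a b
    | .inl _, .inr _ => True
    | .inr _, .inl _ => False

/-- Isomorphism of digraphs. -/
def DigraphIso {V W : Type*} (G : Digraph V) (H : Digraph W) : Prop :=
  Nonempty (G.Adj ≃r H.Adj)

/-- Oriented threshold graphs: the smallest class of digraphs, closed under isomorphism, that
contains `•` and, with `G`, also `G ⊕ •`, `G ⊘ •` and `• ⊘ G`. -/
inductive IsOrientedThreshold : ∀ {V : Type u}, Digraph V → Prop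
  | single : IsOrientedThreshold bullet
  | union_single {V : Type u} {G : Digraph V} :
      IsOrientedThreshold G → IsOrientedThreshold (disjUnion G bullet)
  | order_single {V : Type u} {G : Digraph V} :
      IsOrientedThreshold G → IsOrientedThreshold (orderComp G bullet)
  | single_order {V : Type u} {G : Digraph V} :
      IsOrientedThreshold G → IsOrientedThreshold (orderComp bullet G)
  | of_iso {V W : Type u} {G : Digraph V} {H : Digraph W} :
      DigraphIso G H → IsOrientedThreshold G → IsOrientedThreshold H

/-- Oriented co-trivially perfect graphs: the smallest class of digraphs, closed under isomorphism,
that contains `•` and, with `G`, also `G ⊘ •`, `• ⊘ G` and `G ⊕ •`. -/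
inductive IsOrientedCoTriviallyPerfect : ∀ {V : Type u}, Digraph V → Prop
  | single : IsOrientedCoTriviallyPerfect bullet
  | order_single {V : Type u} {G : Digraph V} :
      IsOrientedCoTriviallyPerfect G → IsOrientedCoTriviallyPerfect (orderComp G bullet)
  | single_order {V : Type u} {G : Digraph V} :
      IsOrientedCoTriviallyPerfect G → IsOrientedCoTriviallyPerfect (orderComp bullet G)
  | union_single {V : Type u} {G : Digraph V} :
      IsOrientedCoTriviallyPerfect G → IsOrientedCoTriviallyPerfect (disjUnion G bullet)
  | of_iso {V W : Type u} {G : Digraph V} {H : Digraph W} :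
      DigraphIso G H → IsOrientedCoTriviallyPerfect G → IsOrientedCoTriviallyPerfect H

/-! ### Undirected graph classes -/

/-- The one-vertex graph `•`. -/
def ubullet : SimpleGraph PUnit.{u + 1} := ⊥

/-- The join `G ⊗ H`: disjoint union plus all edges between `G` and `H`. -/
def ujoin {V W : Type u} (G : SimpleGraph V) (H : SimpleGraph W) : SimpleGraph (V ⊕ W) where
  Adj
    | .inl a, .inl b => G.Adj a b
    | .inr a, .inr b => H.Adj a b
    | _, _ => True
  symm := ⟨by
    rintro (a | a) (b | b) h
    · exact G.adj_symm h
    · trivial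
    · trivial
    · exact H.adj_symm h⟩
  loopless := ⟨by
    rintro (a | a) h
    · exact G.loopless.irrefl a h
    · exact H.loopless.irrefl a h⟩

/-- Co-graphs: generated from `•` by disjoint union and join. -/
inductive IsCograph : ∀ {V : Type u}, SimpleGraph V → Prop
  | single : IsCograph ubullet
  | union {V W : Type u} {G : SimpleGraph V} {H : SimpleGraph W} :
      IsCograph G → IsCograph H → IsCograph (G ⊕g H)
  | join {V W : Type u} {G : SimpleGraph V} {H : SimpleGraph W} :
      IsCograph G → IsCograph H → IsCograph (ujoin G H)
  | of_iso {V W : Type u} {G : SimpleGraph V} {H : SimpleGraph W} :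
      Nonempty (G ≃g H) → IsCograph G → IsCograph H

/-- Co-trivially perfect graphs: generated from `•` by adding an isolated vertex and by join. -/
inductive IsCoTriviallyPerfect : ∀ {V : Type u}, SimpleGraph V → Prop
  | single : IsCoTriviallyPerfect ubullet
  | union_single {V : Type u} {G : SimpleGraph V} :
      IsCoTriviallyPerfect G → IsCoTriviallyPerfect (G ⊕g ubullet.{u})
  | join {V W : Type u} {G : SimpleGraph V} {H : SimpleGraph W} :
      IsCoTriviallyPerfect G → IsCoTriviallyPerfect H → IsCoTriviallyPerfect (ujoin G H)
  | of_iso {V W : Type u} {G : SimpleGraph V} {H : SimpleGraph W} :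
      Nonempty (G ≃g H) → IsCoTriviallyPerfect G → IsCoTriviallyPerfect H

/-- Threshold graphs: generated from `•` by adding an isolated or a dominating vertex. -/
inductive IsThreshold : ∀ {V : Type u}, SimpleGraph V → Prop
  | single : IsThreshold ubullet
  | union_single {V : Type u} {G : SimpleGraph V} :
      IsThreshold G → IsThreshold (G ⊕g ubullet.{u})
  | join_single {V : Type u} {G : SimpleGraph V} :
      IsThreshold G → IsThreshold (ujoin G ubullet)
  | of_iso {V W : Type u} {G : SimpleGraph V} {H : SimpleGraph W} :
      Nonempty (G ≃g H) → IsThreshold G → IsThreshold H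

/-! ### Forbidden induced sub(di)graphs -/

/-- The subdigraph of `G` induced by a vertex set `S`. -/
def induce {V : Type*} (G : Digraph V) (S : Set V) : Digraph S where
  Adj a b := G.Adj a b

/-- `G ∈ Free(F)`: no induced subdigraph of `G` is isomorphic to a member of `F`. -/
def DFree (F : Set (Σ n : ℕ, Digraph (Fin n))) {V : Type*} (G : Digraph V) : Prop :=
  ∀ H ∈ F, ¬ ∃ S : Set V, DigraphIso H.2 (induce G S)

/-- `G ∈ Free(F)`: no induced subgraph of `G` is isomorphic to a member of `F`. -/
def UFree (F : Set (Σ n : ℕ, SimpleGraph (Fin n))) {V : Type*} (G : SimpleGraph V) : Prop :=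
  ∀ H ∈ F, ¬ ∃ S : Set V, Nonempty (H.2 ≃g G.induce S)

/-- The digraph on `{0, …, n - 1}` with a given finite set of arcs. -/
def ofArcs (n : ℕ) (A : Finset (Fin n × Fin n)) : Σ n : ℕ, Digraph (Fin n) :=
  ⟨n, { Adj := fun a b => (a, b) ∈ A }⟩

/-- `D₁`: the directed path on three vertices. -/
def D1 : Σ n : ℕ, Digraph (Fin n) := ofArcs 3 {(0, 1), (1, 2)}

/-- `D₅`: the directed cycle on three vertices. -/
def D5 : Σ n : ℕ, Digraph (Fin n) := ofArcs 3 {(0, 1), (1, 2), (2, 0)}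

/-- `D₈`: the transitive orientation of the path on four vertices. -/
def D8 : Σ n : ℕ, Digraph (Fin n) := ofArcs 4 {(0, 1), (2, 1), (2, 3)}

/-- `D₁₂`: the transitive orientation of the cycle on four vertices. -/
def D12 : Σ n : ℕ, Digraph (Fin n) := ofArcs 4 {(0, 2), (0, 3), (1, 2), (1, 3)}

/-- Two disjoint copies of a single arc. -/
def twoArcs : Σ n : ℕ, Digraph (Fin n) := ofArcs 4 {(0, 1), (2, 3)}

/-- The bidirectional complete digraph on two vertices. -/
def biK2 : Σ n : ℕ, Digraph (Fin n) := ofArcs 2 {(0, 1), (1, 0)}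

/-- The path on four vertices. -/
def P4 : Σ n : ℕ, SimpleGraph (Fin n) := ⟨4, SimpleGraph.pathGraph 4⟩

/-- The cycle on four vertices. -/
def C4 : Σ n : ℕ, SimpleGraph (Fin n) := ⟨4, SimpleGraph.cycleGraph 4⟩

/-- Two disjoint copies of a single edge. -/
def twoK2 : Σ n : ℕ, SimpleGraph (Fin n) := ⟨4, SimpleGraph.fromEdgeSet {s(0, 1), s(2, 3)}⟩

/-- A digraph is transitive if arcs `(u, v)`, `(v, w)` with `u ≠ w` imply the arc `(u, w)`. -/
def IsTransitive {V : Type*} (G : Digraph V) : Prop :=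
  ∀ u v w : V, G.Adj u v → G.Adj v w → u ≠ w → G.Adj u w

/-- The underlying undirected graph of a digraph. -/
abbrev un {V : Type*} (G : Digraph V) : SimpleGraph V := G.toSimpleGraphInclusive

end DiCograph

namespace DiCograph

/-! ### Forbidden induced sub(di)graphs as embeddings -/

/-! For a loopless digraph, excluding `biK2` means asymmetry, and then excluding `D1` and `D5` means
transitivity. So `G` is a strict order and `un G` its comparability graph. Transitivity forces the
orientation of an induced path or cycle on four vertices, so excluding `D8`, `D12`, `twoArcs` from
`G` is excluding `P4`, `C4`, `twoK2` from `un G` (`noP4_un_iff`, `noC4_un_iff`, `noTwoK2_un_iff`).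
Every condition thus sits between generation by the threshold operations and being a strict order
without these three patterns.

The return is `isOrientedThreshold_of_free`, which peels off vertices. A finite graph without the
three patterns has an isolated or a dominating vertex (`exists_isolated_or_dominating`). A
dominating `v` is comparable to everything; if the elements below `v`, or those above it, form a
chain, the order has a least, respectively greatest, element. Otherwise an incomparable pair below
and one above `v` would form an induced `C4`. -/

/-- `H` is isomorphic to an induced subdigraph of `G`. -/
def DContains {V : Type*} (H : Σ n : ℕ, Digraph (Fin n)) (G : Digraph V) : Prop :=
  ∃ f : Fin H.1 → V, Function.Injective f ∧ ∀ i j, G.Adj (f i) (f j) ↔ H.2.Adj i j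

/-- `H` is isomorphic to an induced subgraph of `G`. -/
def UContains {V : Type*} (H : Σ n : ℕ, SimpleGraph (Fin n)) (G : SimpleGraph V) : Prop :=
  ∃ f : Fin H.1 → V, Function.Injective f ∧ ∀ i j, G.Adj (f i) (f j) ↔ H.2.Adj i j

theorem exists_digraphIso_induce_iff {V : Type*} (H : Σ n : ℕ, Digraph (Fin n)) (G : Digraph V) :
    (∃ S : Set V, DigraphIso H.2 (induce G S)) ↔ DContains H G := by
  constructor
  · rintro ⟨S, ⟨e⟩⟩
    exact ⟨fun i => (e i : V), fun i j h => e.injective (Subtype.ext h),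
      fun i j => e.map_rel_iff⟩
  · rintro ⟨f, hf, h⟩
    exact ⟨Set.range f, ⟨⟨Equiv.ofInjective f hf, fun {i j} => h i j⟩⟩⟩

theorem exists_iso_induce_iff {V : Type*} (H : Σ n : ℕ, SimpleGraph (Fin n))
    (G : SimpleGraph V) :
    (∃ S : Set V, Nonempty (H.2 ≃g G.induce S)) ↔ UContains H G := by
  constructor
  · rintro ⟨S, ⟨e⟩⟩
    exact ⟨fun i => (e i : V), fun i j h => e.injective (Subtype.ext h),
      fun i j => e.map_rel_iff⟩
  · rintro ⟨f, hf, h⟩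
    exact ⟨Set.range f, ⟨⟨Equiv.ofInjective f hf, fun {i j} => h i j⟩⟩⟩

theorem dContains_ofArcs {V : Type*} (n : ℕ) (A : Finset (Fin n × Fin n)) (G : Digraph V) :
    DContains (ofArcs n A) G ↔
      ∃ f : Fin n → V, Function.Injective f ∧ ∀ i j, G.Adj (f i) (f j) ↔ (i, j) ∈ A := Iff.rfl

theorem uContains_mk {V : Type*} {n : ℕ} (H : SimpleGraph (Fin n)) (G : SimpleGraph V) :
    UContains ⟨n, H⟩ G ↔
      ∃ f : Fin n → V, Function.Injective f ∧ ∀ i j, G.Adj (f i) (f j) ↔ H.Adj i j := Iff.rfl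

theorem dFree_iff {V : Type*} (F : Set (Σ n : ℕ, Digraph (Fin n))) (G : Digraph V) :
    DFree F G ↔ ∀ H ∈ F, ¬ DContains H G := by
  simp only [DFree, exists_digraphIso_induce_iff]

theorem uFree_iff {V : Type*} (F : Set (Σ n : ℕ, SimpleGraph (Fin n))) (G : SimpleGraph V) :
    UFree F G ↔ ∀ H ∈ F, ¬ UContains H G := by
  simp only [UFree, exists_iso_induce_iff]

/-! ### Undirected patterns on four vertices -/

/-- No induced path on four vertices. -/
def NoP4 {V : Type*} (G : SimpleGraph V) : Prop :=
  ∀ a b c d, G.Adj a b → G.Adj b c → G.Adj c d →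
    ¬ G.Adj a c → ¬ G.Adj a d → ¬ G.Adj b d → False

/-- No induced cycle on four vertices. -/
def NoC4 {V : Type*} (G : SimpleGraph V) : Prop :=
  ∀ a b c d, G.Adj a b → G.Adj b c → G.Adj c d → G.Adj d a →
    a ≠ c → b ≠ d → ¬ G.Adj a c → ¬ G.Adj b d → False

/-- No two independent edges. -/
def NoTwoK2 {V : Type*} (G : SimpleGraph V) : Prop :=
  ∀ a b c d, G.Adj a b → G.Adj c d →
    ¬ G.Adj a c → ¬ G.Adj a d → ¬ G.Adj b c → ¬ G.Adj b d → False

theorem injective_vec_four {V : Type*} {a b c d : V} (hab : a ≠ b) (hac : a ≠ c) (had : a ≠ d)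
    (hbc : b ≠ c) (hbd : b ≠ d) (hcd : c ≠ d) : Function.Injective ![a, b, c, d] := by
  intro i j h
  fin_cases i <;> fin_cases j <;> simp_all [eq_comm]

theorem injective_vec_three {V : Type*} {a b c : V} (hab : a ≠ b) (hac : a ≠ c)
    (hbc : b ≠ c) : Function.Injective ![a, b, c] := by
  intro i j h
  fin_cases i <;> fin_cases j <;> simp_all [eq_comm]

theorem noP4_iff {V : Type*} (G : SimpleGraph V) : NoP4 G ↔ ¬ UContains P4 G := by
  rw [P4, uContains_mk]
  constructor
  · rintro h ⟨f, -, hf⟩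
    refine h (f 0) (f 1) (f 2) (f 3) ?_ ?_ ?_ ?_ ?_ ?_ <;> rw [hf] <;>
      simp [SimpleGraph.pathGraph_adj]
  · intro h a b c d hab hbc hcd hac had hbd
    refine h ⟨![a, b, c, d], injective_vec_four hab.ne ?_ ?_ hbc.ne ?_ hcd.ne, ?_⟩
    · rintro rfl; exact had hcd
    · rintro rfl; exact hac hcd.symm
    · rintro rfl; exact had hab
    · intro i j
      fin_cases i <;> fin_cases j <;>
        simp_all [SimpleGraph.pathGraph_adj, G.adj_comm]

/-- Unlike for `P4` and `twoK2`, the adjacency conditions do not separate opposite vertices, so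
their distinctness is part of the pattern. -/
theorem noC4_iff {V : Type*} (G : SimpleGraph V) : NoC4 G ↔ ¬ UContains C4 G := by
  rw [C4, uContains_mk]
  constructor
  · rintro h ⟨f, hi, hf⟩
    refine h (f 0) (f 1) (f 2) (f 3) ?_ ?_ ?_ ?_ (hi.ne (by decide)) (hi.ne (by decide)) ?_ ?_ <;>
      rw [hf] <;> simp [SimpleGraph.cycleGraph_adj] <;> decide
  · intro h a b c d hab hbc hcd hda hac' hbd' hac hbd
    refine h ⟨![a, b, c, d], injective_vec_four hab.ne hac' hda.ne' hbc.ne hbd' hcd.ne, ?_⟩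
    intro i j
    fin_cases i <;> fin_cases j <;>
      simp_all [SimpleGraph.cycleGraph_adj, G.adj_comm] <;> decide

theorem noTwoK2_iff {V : Type*} (G : SimpleGraph V) : NoTwoK2 G ↔ ¬ UContains twoK2 G := by
  rw [twoK2, uContains_mk]
  constructor
  · rintro h ⟨f, -, hf⟩
    refine h (f 0) (f 1) (f 2) (f 3) ?_ ?_ ?_ ?_ ?_ ?_ <;> rw [hf] <;> simp
  · intro h a b c d hab hcd hac had hbc hbd
    refine h ⟨![a, b, c, d], injective_vec_four hab.ne ?_ ?_ ?_ ?_ hcd.ne, ?_⟩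
    · rintro rfl; exact had hcd
    · rintro rfl; exact hac hcd.symm
    · rintro rfl; exact hbd hcd
    · rintro rfl; exact hbc hcd.symm
    · intro i j
      fin_cases i <;> fin_cases j <;> simp_all [G.adj_comm]

/-! ### Undirected classes -/

section ujoin
variable {V W : Type u} (G : SimpleGraph V) (H : SimpleGraph W)

@[simp] theorem ujoin_inl_inl (a b : V) : (ujoin G H).Adj (.inl a) (.inl b) ↔ G.Adj a b := Iff.rfl
@[simp] theorem ujoin_inr_inr (a b : W) : (ujoin G H).Adj (.inr a) (.inr b) ↔ H.Adj a b := Iff.rfl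
@[simp] theorem ujoin_inl_inr (a : V) (b : W) : (ujoin G H).Adj (.inl a) (.inr b) := trivial
@[simp] theorem ujoin_inr_inl (a : W) (b : V) : (ujoin G H).Adj (.inr a) (.inl b) := trivial
@[simp] theorem not_ubullet_adj (a b : PUnit.{u + 1}) : ¬ ubullet.Adj a b := id

end ujoin

theorem NoP4.iso {V W : Type*} {G : SimpleGraph V} {H : SimpleGraph W} (e : G ≃g H)
    (h : NoP4 G) : NoP4 H := by
  intro a b c d
  simpa only [e.symm.map_adj_iff] using h (e.symm a) (e.symm b) (e.symm c) (e.symm d)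

theorem NoC4.iso {V W : Type*} {G : SimpleGraph V} {H : SimpleGraph W} (e : G ≃g H)
    (h : NoC4 G) : NoC4 H := by
  intro a b c d
  simpa only [e.symm.map_adj_iff, e.symm.injective.ne_iff] using
    h (e.symm a) (e.symm b) (e.symm c) (e.symm d)

theorem NoTwoK2.iso {V W : Type*} {G : SimpleGraph V} {H : SimpleGraph W} (e : G ≃g H)
    (h : NoTwoK2 G) : NoTwoK2 H := by
  intro a b c d
  simpa only [e.symm.map_adj_iff] using h (e.symm a) (e.symm b) (e.symm c) (e.symm d)

theorem noP4_ubullet : NoP4 ubullet.{u} := fun _ _ _ _ h => h.elim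

/-- `P4` and its complement are both connected, so an induced copy in a union or a join lies on one
side. -/
theorem NoP4.sum {V W : Type u} {G : SimpleGraph V} {H : SimpleGraph W}
    (hG : NoP4 G) (hH : NoP4 H) : NoP4 (G ⊕g H) := by
  rintro (a | a) (b | b) (c | c) (d | d) <;> simp
  · simpa using hG a b c d
  · simpa using hH a b c d

theorem NoP4.ujoin {V W : Type u} {G : SimpleGraph V} {H : SimpleGraph W}
    (hG : NoP4 G) (hH : NoP4 H) : NoP4 (ujoin G H) := by
  rintro (a | a) (b | b) (c | c) (d | d) <;> simp
  · simpa using hG a b c d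
  · simpa using hH a b c d

theorem noTwoK2_ubullet : NoTwoK2 ubullet.{u} := fun _ _ _ _ h => h.elim

theorem NoTwoK2.sum_ubullet {V : Type u} {G : SimpleGraph V} (hG : NoTwoK2 G) :
    NoTwoK2 (G ⊕g ubullet.{u}) := by
  rintro (a | a) (b | b) (c | c) (d | d) <;> simp
  simpa using hG a b c d

theorem NoTwoK2.ujoin {V W : Type u} {G : SimpleGraph V} {H : SimpleGraph W}
    (hG : NoTwoK2 G) (hH : NoTwoK2 H) : NoTwoK2 (ujoin G H) := by
  rintro (a | a) (b | b) (c | c) (d | d) <;> simp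
  · simpa using hG a b c d
  · simpa using hH a b c d

theorem noC4_ubullet : NoC4 ubullet.{u} := fun _ _ _ _ h => h.elim

theorem NoC4.sum_ubullet {V : Type u} {G : SimpleGraph V} (hG : NoC4 G) :
    NoC4 (G ⊕g ubullet.{u}) := by
  rintro (a | a) (b | b) (c | c) (d | d) <;> simp
  simpa using hG a b c d

/-- Every vertex of `C4` misses another one, so a dominating vertex lies on no induced copy. A
general join fails: `C4` is itself the join of two edgeless pairs. -/
theorem NoC4.ujoin_ubullet {V : Type u} {G : SimpleGraph V} (hG : NoC4 G) :
    NoC4 (DiCograph.ujoin G ubullet.{u}) := by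
  rintro (a | a) (b | b) (c | c) (d | d) <;> simp +contextual
  simpa using hG a b c d

theorem IsCograph.noP4 {V : Type u} {G : SimpleGraph V} (h : IsCograph G) : NoP4 G := by
  induction h with
  | single => exact noP4_ubullet
  | union _ _ h₁ h₂ => exact h₁.sum h₂
  | join _ _ h₁ h₂ => exact h₁.ujoin h₂
  | of_iso e _ h => exact h.iso e.some

theorem IsCoTriviallyPerfect.isCograph {V : Type u} {G : SimpleGraph V}
    (h : IsCoTriviallyPerfect G) : IsCograph G := by
  induction h with
  | single => exact .single
  | union_single _ h => exact .union h .single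
  | join _ _ h₁ h₂ => exact .join h₁ h₂
  | of_iso e _ h => exact .of_iso e h

theorem IsCoTriviallyPerfect.noTwoK2 {V : Type u} {G : SimpleGraph V}
    (h : IsCoTriviallyPerfect G) : NoTwoK2 G := by
  induction h with
  | single => exact noTwoK2_ubullet
  | union_single _ h => exact h.sum_ubullet
  | join _ _ h₁ h₂ => exact h₁.ujoin h₂
  | of_iso e _ h => exact h.iso e.some

theorem IsThreshold.isCoTriviallyPerfect {V : Type u} {G : SimpleGraph V}
    (h : IsThreshold G) : IsCoTriviallyPerfect G := by
  induction h with
  | single => exact .single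
  | union_single _ h => exact .union_single h
  | join_single _ h => exact .join h .single
  | of_iso e _ h => exact .of_iso e h

theorem IsThreshold.noC4 {V : Type u} {G : SimpleGraph V} (h : IsThreshold G) : NoC4 G := by
  induction h with
  | single => exact noC4_ubullet
  | union_single _ h => exact h.sum_ubullet
  | join_single _ h => exact h.ujoin_ubullet
  | of_iso e _ h => exact h.iso e.some

/-- In a graph without induced `P₄`, `C₄`, `2K₂`, neighbourhoods are nested. -/
theorem neighbors_nested {V : Type*} {G : SimpleGraph V} (hP : NoP4 G) (hC : NoC4 G)
    (hK : NoTwoK2 G) {x y a b : V} (hxa : G.Adj x a) (hya : ¬ G.Adj y a) (hay : a ≠ y)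
    (hyb : G.Adj y b) (hxb : ¬ G.Adj x b) (hbx : b ≠ x) : False := by
  -- The edges `xa`, `yb` and non-edges `ya`, `xb` are fixed; the two remaining pairs `xy`, `ab`
  -- decide which of the three patterns appears.
  by_cases hxy : G.Adj x y <;> by_cases hab : G.Adj a b
  · exact hC a x y b hxa.symm hxy hyb hab.symm hay hbx.symm (fun h => hya h.symm) hxb
  · exact hP a x y b hxa.symm hxy hyb (fun h => hya h.symm) hab hxb
  · exact hP x a b y hxa hab hyb.symm hxb hxy (fun h => hya h.symm)
  · exact hK x a y b hxa hyb hxy hxb (fun h => hya h.symm) hab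

/-- A vertex `v` of maximum degree dominates, or else any non-neighbour `w` of it is isolated: by
nestedness, a neighbour `a` of `w` would have larger degree than `v`. -/
theorem exists_isolated_or_dominating {V : Type*} [Finite V] [Nonempty V] {G : SimpleGraph V}
    (hP : NoP4 G) (hC : NoC4 G) (hK : NoTwoK2 G) :
    ∃ v, (∀ x, ¬ G.Adj v x) ∨ ∀ x, x ≠ v → G.Adj v x := by
  classical
  obtain ⟨v, hv⟩ := Finite.exists_max fun v => (G.neighborSet v).ncard
  by_cases hd : ∀ x, x ≠ v → G.Adj v x
  · exact ⟨v, .inr hd⟩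
  push Not at hd
  obtain ⟨w, hwv, hw⟩ := hd
  refine ⟨w, .inl fun a hwa => ?_⟩
  have hav : a ≠ v := by rintro rfl; exact hw hwa.symm
  have hsub : ∀ x, G.Adj v x → x ≠ a → G.Adj a x := by
    intro x hvx hxa
    by_contra hax
    exact neighbors_nested hP hC hK hvx hax hxa hwa.symm hw hwv
  -- Since `v` may itself be adjacent to `a`, the neighbourhoods are compared after swapping `v` and
  -- `a`; the inclusion is strict because `w` is missed.
  have hlt : (Equiv.swap v a '' G.neighborSet v).ncard < (G.neighborSet a).ncard := by
    refine Set.ncard_lt_ncard ⟨?_, fun h => ?_⟩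
    · rintro _ ⟨x, hx, rfl⟩
      have hx : G.Adj v x := hx
      by_cases hxa : x = a
      · subst hxa; simpa using hx.symm
      · rw [Equiv.swap_apply_of_ne_of_ne hx.ne' hxa]
        exact hsub x hx hxa
    · obtain ⟨x, hx, hxw⟩ := h (show w ∈ G.neighborSet a from hwa.symm)
      rw [Equiv.swap_apply_eq_iff, Equiv.swap_apply_of_ne_of_ne hwv hwa.ne] at hxw
      exact hw (hxw ▸ hx)
  rw [Set.ncard_image_of_injective _ (Equiv.swap v a).injective] at hlt
  exact absurd (hv a) (not_le.2 hlt)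

/-! ### Strict orders -/

/-- `G` has no pair of opposite arcs. -/
def IsAsymmetric {V : Type*} (G : Digraph V) : Prop :=
  ∀ a b, G.Adj a b → ¬ G.Adj b a

theorem IsTransitive.trans {V : Type*} {G : Digraph V} (ht : IsTransitive G)
    (ha : IsAsymmetric G) {a b c : V} (hab : G.Adj a b) (hbc : G.Adj b c) : G.Adj a c :=
  ht a b c hab hbc (by rintro rfl; exact ha _ _ hab hbc)

theorem IsAsymmetric.irrefl {V : Type*} {G : Digraph V} (ha : IsAsymmetric G) (a : V) :
    ¬ G.Adj a a := fun h => ha a a h h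

theorem un_adj {V : Type*} {G : Digraph V} (ha : IsAsymmetric G) (a b : V) :
    (un G).Adj a b ↔ G.Adj a b ∨ G.Adj b a := by
  simp only [un, Digraph.toSimpleGraphInclusive, SimpleGraph.fromRel_adj]
  refine ⟨fun h => h.2, fun h => ⟨?_, h⟩⟩
  rintro rfl
  exact h.elim (ha.irrefl a) (ha.irrefl a)

/-- Looplessness is needed because asymmetry also forbids loops. -/
theorem not_dContains_biK2 {V : Type*} {G : Digraph V} (hG : ∀ v, ¬ G.Adj v v) :
    ¬ DContains biK2 G ↔ IsAsymmetric G := by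
  rw [biK2, dContains_ofArcs]
  constructor
  · intro h a b hab hba
    have hne : a ≠ b := by rintro rfl; exact hG a hab
    refine h ⟨![a, b], ?_, ?_⟩
    · intro i j h
      fin_cases i <;> fin_cases j <;> simp_all [eq_comm]
    · intro i j
      fin_cases i <;> fin_cases j <;> simp_all
  · rintro h ⟨f, -, hf⟩
    refine h (f 0) (f 1) ?_ ?_ <;> rw [hf] <;> simp

theorem IsAsymmetric.not_dContains {V : Type*} {G : Digraph V} (ha : IsAsymmetric G)
    (ht : IsTransitive G) : ¬ DContains D1 G ∧ ¬ DContains D5 G := by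
  rw [D1, D5, dContains_ofArcs, dContains_ofArcs]
  constructor <;> rintro ⟨f, -, hf⟩ <;>
    have h02 := ht.trans ha (a := f 0) (b := f 1) (c := f 2)
      ((hf _ _).2 (by simp)) ((hf _ _).2 (by simp)) <;>
    rw [hf] at h02 <;> simp at h02

/-- Arcs `uv`, `vw` without `uw` induce `D5` or `D1`, according to whether `wu` is an arc. -/
theorem IsAsymmetric.isTransitive {V : Type*} {G : Digraph V} (ha : IsAsymmetric G)
    (h1 : ¬ DContains D1 G) (h5 : ¬ DContains D5 G) : IsTransitive G := by
  rw [D1, dContains_ofArcs] at h1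
  rw [D5, dContains_ofArcs] at h5
  intro u v w huv hvw huw
  by_contra h
  have hi : Function.Injective ![u, v, w] := injective_vec_three
    (by rintro rfl; exact ha.irrefl _ huv) huw (by rintro rfl; exact ha.irrefl _ hvw)
  have := ha.irrefl u
  have := ha.irrefl v
  have := ha.irrefl w
  have := ha _ _ huv
  have := ha _ _ hvw
  by_cases hwu : G.Adj w u
  · refine h5 ⟨![u, v, w], hi, fun i j => ?_⟩
    fin_cases i <;> fin_cases j <;> simp_all
  · refine h1 ⟨![u, v, w], hi, fun i j => ?_⟩
    fin_cases i <;> fin_cases j <;> simp_all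

/-- Two consecutive arcs in the same direction would create a chord, so the orientation of an
induced path alternates. -/
theorem noP4_un_iff {V : Type*} {G : Digraph V} (ha : IsAsymmetric G) (ht : IsTransitive G) :
    NoP4 (un G) ↔ ¬ DContains D8 G := by
  rw [D8, dContains_ofArcs]
  constructor
  · rintro h ⟨f, -, hf⟩
    refine h (f 0) (f 1) (f 2) (f 3) ?_ ?_ ?_ ?_ ?_ ?_ <;> rw [un_adj ha, hf, hf] <;>
      simp
  · intro h
    have key : ∀ a b c d, G.Adj a b → (un G).Adj b c → (un G).Adj c d →
        ¬ (un G).Adj a c → ¬ (un G).Adj a d → ¬ (un G).Adj b d → False := by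
      intro a b c d hab hbc hcd hac had hbd
      simp only [un_adj ha, not_or] at *
      have hcb : G.Adj c b := hbc.resolve_left fun h => hac.1 (ht.trans ha hab h)
      have hcd : G.Adj c d := hcd.resolve_right fun h => hbd.2 (ht.trans ha h hcb)
      have := ha.irrefl
      have := ha _ _ hab
      have := ha _ _ hcb
      have := ha _ _ hcd
      refine h ⟨![a, b, c, d], injective_vec_four ?_ ?_ ?_ ?_ ?_ ?_, fun i j => ?_⟩
      iterate 6 rintro rfl; simp_all
      fin_cases i <;> fin_cases j <;> simp_all
    intro a b c d hab hbc hcd hac had hbd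
    rcases (un_adj ha a b).1 hab with h' | h'
    · exact key a b c d h' hbc hcd hac had hbd
    -- If the first arc points backwards, alternation makes the last one `d → c`, so the path read
    -- from `d` starts with a forward arc.
    · have hcb : G.Adj b c := ((un_adj ha b c).1 hbc).resolve_right fun h =>
        hac ((un_adj ha _ _).2 (.inr (ht.trans ha h h')))
      have hdc : G.Adj d c := ((un_adj ha c d).1 hcd).resolve_left fun h =>
        hbd ((un_adj ha _ _).2 (.inl (ht.trans ha hcb h)))
      exact key d c b a hdc hbc.symm hab.symm (fun h => hbd h.symm) (fun h => had h.symm)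
        (fun h => hac h.symm)

theorem noC4_un_iff {V : Type*} {G : Digraph V} (ha : IsAsymmetric G) (ht : IsTransitive G) :
    NoC4 (un G) ↔ ¬ DContains D12 G := by
  rw [D12, dContains_ofArcs]
  constructor
  · rintro h ⟨f, hi, hf⟩
    refine h (f 0) (f 2) (f 1) (f 3) ?_ ?_ ?_ ?_ (hi.ne (by decide)) (hi.ne (by decide)) ?_ ?_ <;>
      rw [un_adj ha, hf, hf] <;> simp
  · intro h
    have key : ∀ a b c d, G.Adj a b → (un G).Adj b c → (un G).Adj c d → (un G).Adj d a →
        a ≠ c → b ≠ d → ¬ (un G).Adj a c → ¬ (un G).Adj b d → False := by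
      intro a b c d hab hbc hcd hda hac' hbd' hac hbd
      simp only [un_adj ha, not_or] at *
      have hcb : G.Adj c b := hbc.resolve_left fun h => hac.1 (ht.trans ha hab h)
      have hcd : G.Adj c d := hcd.resolve_right fun h => hbd.2 (ht.trans ha h hcb)
      have had : G.Adj a d := hda.resolve_left fun h => hbd.2 (ht.trans ha h hab)
      have := ha.irrefl
      have := ha _ _ hab
      have := ha _ _ hcb
      have := ha _ _ hcd
      have := ha _ _ had
      -- Alternation makes the opposite vertices `a`, `c` the sources, hence the order of the
      -- labels.
      refine h ⟨![a, c, b, d], injective_vec_four hac' ?_ ?_ ?_ ?_ hbd', fun i j => ?_⟩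
      iterate 4 rintro rfl; simp_all
      fin_cases i <;> fin_cases j <;> simp_all
    intro a b c d hab hbc hcd hda hac' hbd' hac hbd
    rcases (un_adj ha a b).1 hab with h' | h'
    · exact key a b c d h' hbc hcd hda hac' hbd' hac hbd
    · exact key b a d c h' hda.symm hcd.symm hbc.symm hbd' hac' hbd hac

theorem noTwoK2_un_iff {V : Type*} {G : Digraph V} (ha : IsAsymmetric G) :
    NoTwoK2 (un G) ↔ ¬ DContains twoArcs G := by
  rw [twoArcs, dContains_ofArcs]
  constructor
  · rintro h ⟨f, -, hf⟩
    refine h (f 0) (f 1) (f 2) (f 3) ?_ ?_ ?_ ?_ ?_ ?_ <;> rw [un_adj ha, hf, hf] <;>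
      simp
  · intro h
    have key : ∀ a b c d, G.Adj a b → G.Adj c d → ¬ (un G).Adj a c → ¬ (un G).Adj a d →
        ¬ (un G).Adj b c → ¬ (un G).Adj b d → False := by
      intro a b c d hab hcd hac had hbc hbd
      simp only [un_adj ha, not_or] at *
      have := ha.irrefl
      have := ha _ _ hab
      have := ha _ _ hcd
      refine h ⟨![a, b, c, d], injective_vec_four ?_ ?_ ?_ ?_ ?_ ?_, fun i j => ?_⟩
      iterate 6 rintro rfl; simp_all
      fin_cases i <;> fin_cases j <;> simp_all
    intro a b c d hab hcd hac had hbc hbd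
    rcases (un_adj ha a b).1 hab with h' | h' <;> rcases (un_adj ha c d).1 hcd with h'' | h''
    · exact key a b c d h' h'' hac had hbc hbd
    · exact key a b d c h' h'' had hac hbd hbc
    · exact key b a c d h' h'' hbc hbd hac had
    · exact key b a d c h' h'' hbd hbc had hac

/-! ### Oriented threshold graphs -/

section operations
variable {V W : Type u} (G : Digraph V) (H : Digraph W)

@[simp] theorem disjUnion_inl_inl (a b : V) :
    (disjUnion G H).Adj (.inl a) (.inl b) ↔ G.Adj a b := Iff.rfl
@[simp] theorem disjUnion_inr_inr (a b : W) :
    (disjUnion G H).Adj (.inr a) (.inr b) ↔ H.Adj a b := Iff.rfl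
@[simp] theorem disjUnion_inl_inr (a : V) (b : W) :
    ¬ (disjUnion G H).Adj (.inl a) (.inr b) := id
@[simp] theorem disjUnion_inr_inl (a : W) (b : V) :
    ¬ (disjUnion G H).Adj (.inr a) (.inl b) := id
@[simp] theorem orderComp_inl_inl (a b : V) :
    (orderComp G H).Adj (.inl a) (.inl b) ↔ G.Adj a b := Iff.rfl
@[simp] theorem orderComp_inr_inr (a b : W) :
    (orderComp G H).Adj (.inr a) (.inr b) ↔ H.Adj a b := Iff.rfl
@[simp] theorem orderComp_inl_inr (a : V) (b : W) :
    (orderComp G H).Adj (.inl a) (.inr b) := trivial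
@[simp] theorem orderComp_inr_inl (a : W) (b : V) :
    ¬ (orderComp G H).Adj (.inr a) (.inl b) := id
@[simp] theorem not_bullet_adj (a b : PUnit.{u + 1}) : ¬ bullet.Adj a b := id

end operations

theorem isOrientedThreshold_iff_isOrientedCoTriviallyPerfect {V : Type u} {G : Digraph V} :
    IsOrientedThreshold G ↔ IsOrientedCoTriviallyPerfect G := by
  constructor <;> intro h
  · induction h with
    | single => exact .single
    | union_single _ h => exact .union_single h
    | order_single _ h => exact .order_single h
    | single_order _ h => exact .single_order h
    | of_iso e _ h => exact .of_iso e h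
  · induction h with
    | single => exact .single
    | union_single _ h => exact .union_single h
    | order_single _ h => exact .order_single h
    | single_order _ h => exact .single_order h
    | of_iso e _ h => exact .of_iso e h

theorem IsOrientedThreshold.isAsymmetric {V : Type u} {G : Digraph V}
    (h : IsOrientedThreshold G) : IsAsymmetric G := by
  induction h with
  | single => exact fun _ _ h => h.elim
  | union_single _ h | order_single _ h | single_order _ h =>
    rintro (a | a) (b | b) <;> first | exact h a b | simp
  | of_iso e _ h =>
    obtain ⟨e⟩ := e
    intro a b
    simpa only [e.symm.map_rel_iff] using h (e.symm a) (e.symm b)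

theorem IsOrientedThreshold.isTransitive {V : Type u} {G : Digraph V}
    (h : IsOrientedThreshold G) : IsTransitive G := by
  induction h with
  | single => exact fun _ _ _ h => h.elim
  | union_single _ h | order_single _ h | single_order _ h =>
    rintro (a | a) (b | b) (c | c) <;> simp
    simpa using h a b c
  | of_iso e _ h =>
    obtain ⟨e⟩ := e
    intro a b c
    simpa only [e.symm.map_rel_iff, e.symm.injective.ne_iff] using
      h (e.symm a) (e.symm b) (e.symm c)

theorem IsOrientedThreshold.isThreshold_un {V : Type u} {G : Digraph V}
    (h : IsOrientedThreshold G) : IsThreshold (un G) := by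
  induction h with
  | single =>
    refine .of_iso ⟨⟨Equiv.refl _, fun {a b} => ?_⟩⟩ .single
    simp [un, Digraph.toSimpleGraphInclusive]
  | union_single _ h =>
    refine .of_iso ⟨⟨Equiv.refl _, ?_⟩⟩ (.union_single h)
    rintro (a | a) (b | b) <;> simp [un, Digraph.toSimpleGraphInclusive]
  | order_single _ h =>
    refine .of_iso ⟨⟨Equiv.refl _, ?_⟩⟩ (.join_single h)
    rintro (a | a) (b | b) <;> simp [un, Digraph.toSimpleGraphInclusive]
  | single_order _ h =>
    refine .of_iso ⟨⟨Equiv.sumComm _ _, ?_⟩⟩ (.join_single h)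
    rintro (a | a) (b | b) <;> simp [un, Digraph.toSimpleGraphInclusive]
  | of_iso e _ h =>
    obtain ⟨e⟩ := e
    refine .of_iso ⟨⟨e.toEquiv, fun {a b} => ?_⟩⟩ h
    simp [un, Digraph.toSimpleGraphInclusive, e.map_rel_iff]

/-- If the elements below a vertex comparable to all others form a chain, some vertex is below
all others. -/
theorem exists_source {V : Type*} [Finite V] {r : V → V → Prop}
    (hirr : ∀ a, ¬ r a a) (htr : ∀ a b c, r a b → r b c → r a c) {v : V}
    (hv : ∀ x, x ≠ v → r v x ∨ r x v)
    (hD : ∀ x y, r x v → r y v → x ≠ y → r x y ∨ r y x) :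
    ∃ m, ∀ x, x ≠ m → r m x := by
  have : IsTrans V r := ⟨htr⟩
  have : Std.Irrefl r := ⟨hirr⟩
  -- A minimal element among `v` and what lies below it is least there, by the chain condition; it
  -- is below the rest through `v`.
  obtain ⟨m, hm, hmin⟩ := (Finite.wellFounded_of_trans_of_irrefl r).has_min
    {x | x = v ∨ r x v} ⟨v, .inl rfl⟩
  refine ⟨m, fun x hx => ?_⟩
  by_cases hxv : x = v
  · subst hxv
    exact hm.resolve_left fun h => hx h.symm
  rcases hv x hxv with h | h
  · rcases hm with rfl | hm
    · exact h
    · exact htr _ _ _ hm h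
  · have hxm := hmin x (.inr h)
    rcases hm with rfl | hm
    · exact (hxm h).elim
    · exact (hD x m h hm hx).resolve_left hxm

theorem exists_isolated_or_source_or_sink {V : Type*} [Finite V] [Nonempty V] {G : Digraph V}
    (ha : IsAsymmetric G) (ht : IsTransitive G) (hP : NoP4 (un G)) (hC : NoC4 (un G))
    (hK : NoTwoK2 (un G)) :
    ∃ v, (∀ x, ¬ G.Adj v x ∧ ¬ G.Adj x v) ∨ (∀ x, x ≠ v → G.Adj v x) ∨
      ∀ x, x ≠ v → G.Adj x v := by
  obtain ⟨v, hv | hv⟩ := exists_isolated_or_dominating hP hC hK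
  · exact ⟨v, .inl fun x => by simpa [un_adj ha] using hv x⟩
  have hv' : ∀ x, x ≠ v → G.Adj v x ∨ G.Adj x v := fun x hx => (un_adj ha v x).1 (hv x hx)
  by_cases hD : ∀ x y, G.Adj x v → G.Adj y v → x ≠ y → G.Adj x y ∨ G.Adj y x
  · obtain ⟨m, hm⟩ := exists_source ha.irrefl (fun a b c => ht.trans ha) hv' hD
    exact ⟨m, .inr (.inl hm)⟩
  push Not at hD
  obtain ⟨x, y, hx, hy, hxy, hxy₁, hxy₂⟩ := hD
  -- Reversed order: the elements above `v` form a chain, since an incomparable pair `z`, `w` there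
  -- would give the induced cycle `x z y w`.
  obtain ⟨m, hm⟩ := exists_source (r := fun a b => G.Adj b a) (v := v) ha.irrefl
    (fun a b c hab hbc => ht.trans ha hbc hab) (fun x hx => (hv' x hx).symm) (by
      intro z w hz hw hzw
      by_contra hn
      refine hC x z y w ?_ ?_ ?_ ?_ hxy hzw ?_ ?_ <;> rw [un_adj ha]
      · exact .inl (ht.trans ha hx hz)
      · exact .inr (ht.trans ha hy hz)
      · exact .inl (ht.trans ha hy hw)
      · exact .inr (ht.trans ha hx hw)
      · exact not_or.2 ⟨hxy₁, hxy₂⟩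
      · exact fun h => hn h.symm)
  exact ⟨m, .inr (.inr hm)⟩

/-- Split off one vertex. -/
def splitVertex {V : Type u} [DecidableEq V] (v : V) :
    ({v}ᶜ : Set V) ⊕ PUnit.{u + 1} ≃ V where
  toFun := Sum.elim Subtype.val fun _ => v
  invFun x := if h : x = v then .inr ⟨⟩ else .inl ⟨x, h⟩
  left_inv := by
    rintro (⟨x, hx⟩ | _)
    · simp [show x ≠ v from hx]
    · simp
  right_inv x := by by_cases h : x = v <;> simp [h]

@[simp] theorem splitVertex_inl {V : Type u} [DecidableEq V] (v : V) (x : ({v}ᶜ : Set V)) :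
    splitVertex v (.inl x) = x := rfl

@[simp] theorem splitVertex_inr {V : Type u} [DecidableEq V] (v : V) (x : PUnit.{u + 1}) :
    splitVertex v (.inr x) = v := rfl

/-- Strong induction on the number of vertices: all hypotheses pass to induced subdigraphs, and an
isolated vertex, source or sink is undone by the matching operation. -/
theorem isOrientedThreshold_of_free {V : Type u} [Finite V] [Nonempty V] {G : Digraph V}
    (ha : IsAsymmetric G) (ht : IsTransitive G) (hP : NoP4 (un G)) (hC : NoC4 (un G))
    (hK : NoTwoK2 (un G)) : IsOrientedThreshold G := by
  classical
  induction hn : Nat.card V using Nat.strong_induction_on generalizing V with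
  | _ n ih =>
  subst hn
  obtain ⟨v, hv⟩ := exists_isolated_or_source_or_sink ha ht hP hC hK
  by_cases hne : Nonempty ({v}ᶜ : Set V)
  · have ha' : IsAsymmetric (induce G {v}ᶜ) := fun a b => ha a b
    have hun : ∀ a b : ({v}ᶜ : Set V), (un (induce G {v}ᶜ)).Adj a b ↔ (un G).Adj a b := by
      intro a b
      rw [un_adj ha, un_adj ha']
      rfl
    have hI : IsOrientedThreshold (induce G {v}ᶜ) := by
      refine ih _ ?_ ha' (fun a b c h₁ h₂ h => ht a b c h₁ h₂ (Subtype.val_injective.ne h))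
        ?_ ?_ ?_ rfl
      · exact Finite.card_subtype_lt (x := v) (by simp)
      · intro a b c d
        simpa only [hun] using hP a b c d
      · intro a b c d
        simpa only [hun, Subtype.coe_injective.ne_iff] using hC a b c d
      · intro a b c d
        simpa only [hun] using hK a b c d
    have hirr := ha.irrefl v
    rcases hv with hv | hv | hv
    · refine .of_iso ⟨⟨splitVertex v, ?_⟩⟩ (.union_single hI)
      rintro (a | a) (b | b) <;> simp [hv, induce]
    · refine .of_iso ⟨⟨(Equiv.sumComm _ _).trans (splitVertex v), ?_⟩⟩ (.single_order hI)
      rintro (a | a) (b | b) <;> simp [hirr, induce]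
      · exact hv _ b.2
      · exact ha _ _ (hv _ a.2)
    · refine .of_iso ⟨⟨splitVertex v, ?_⟩⟩ (.order_single hI)
      rintro (a | a) (b | b) <;> simp [hirr, induce]
      · exact hv _ a.2
      · exact ha _ _ (hv _ b.2)
  · have hall : ∀ x, x = v := fun x => by
      by_contra h
      exact hne ⟨⟨x, h⟩⟩
    have : Unique V := ⟨⟨v⟩, hall⟩
    refine .of_iso ⟨⟨Equiv.ofUnique _ _, fun {a b} => ?_⟩⟩ .single
    rw [Subsingleton.elim (Equiv.ofUnique _ _ b) (Equiv.ofUnique PUnit V a)]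
    simp [ha.irrefl]

end DiCograph

/-! ### The equivalences -/

theorem mainTheorem3 {V : Type u} [Finite V] [Nonempty V] (G : Digraph V)
    (hG : ∀ v, ¬ G.Adj v v) :
    List.TFAE [
      DiCograph.IsOrientedThreshold G,
      DiCograph.IsOrientedCoTriviallyPerfect G,
      DiCograph.DFree {DiCograph.D1, DiCograph.D5, DiCograph.D8, DiCograph.D12,
        DiCograph.twoArcs, DiCograph.biK2} G,
      DiCograph.DFree {DiCograph.D1, DiCograph.D5, DiCograph.biK2} G ∧
        DiCograph.UFree {DiCograph.twoK2, DiCograph.C4, DiCograph.P4} (DiCograph.un G),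
      DiCograph.DFree {DiCograph.D1, DiCograph.D5, DiCograph.biK2} G ∧
        DiCograph.IsThreshold (DiCograph.un G),
      DiCograph.DFree {DiCograph.D1, DiCograph.D5, DiCograph.D12, DiCograph.biK2} G ∧
        DiCograph.UFree {DiCograph.P4, DiCograph.twoK2} (DiCograph.un G),
      DiCograph.DFree {DiCograph.D1, DiCograph.D5, DiCograph.D12, DiCograph.biK2} G ∧
        DiCograph.IsCoTriviallyPerfect (DiCograph.un G),
      DiCograph.DFree {DiCograph.D1, DiCograph.D5, DiCograph.D12, DiCograph.twoArcs,
        DiCograph.biK2} G ∧ DiCograph.UFree {DiCograph.P4} (DiCograph.un G),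
      DiCograph.DFree {DiCograph.D1, DiCograph.D5, DiCograph.D12, DiCograph.twoArcs,
        DiCograph.biK2} G ∧ DiCograph.IsCograph (DiCograph.un G),
      DiCograph.IsTransitive G ∧
        DiCograph.DFree {DiCograph.D8, DiCograph.D12, DiCograph.twoArcs, DiCograph.biK2} G] := by
  simp only [DiCograph.dFree_iff, DiCograph.uFree_iff, Set.mem_insert_iff,
    Set.mem_singleton_iff, forall_eq_or_imp, forall_eq, ← DiCograph.noP4_iff,
    ← DiCograph.noC4_iff, ← DiCograph.noTwoK2_iff, DiCograph.not_dContains_biK2 hG]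
  tfae_have 1 ↔ 2 := DiCograph.isOrientedThreshold_iff_isOrientedCoTriviallyPerfect
  -- Three cycles through 1 and 5: `1 → 5 → 4 → 1`, the detour `5 → 7 → 6 → 4`, and `7 → 9 → 8 → 3 →
  -- 10 → 1`.
  tfae_have 1 → 5 := fun h =>
    have ha := h.isAsymmetric
    have hn := ha.not_dContains h.isTransitive
    ⟨⟨hn.1, hn.2, ha⟩, h.isThreshold_un⟩
  tfae_have 5 → 4 := fun ⟨h, hT⟩ =>
    have hc := hT.isCoTriviallyPerfect
    ⟨h, hc.noTwoK2, hT.noC4, hc.isCograph.noP4⟩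
  tfae_have 4 → 1 := fun ⟨⟨h1, h5, ha⟩, hK, hC, hP⟩ =>
    DiCograph.isOrientedThreshold_of_free ha (ha.isTransitive h1 h5) hP hC hK
  tfae_have 5 → 7 := fun ⟨⟨h1, h5, ha⟩, hT⟩ =>
    ⟨⟨h1, h5, (DiCograph.noC4_un_iff ha (ha.isTransitive h1 h5)).1 hT.noC4, ha⟩,
      hT.isCoTriviallyPerfect⟩
  tfae_have 7 → 6 := fun ⟨h, hT⟩ => ⟨h, hT.isCograph.noP4, hT.noTwoK2⟩
  tfae_have 6 → 4 := fun ⟨⟨h1, h5, h12, ha⟩, hP, hK⟩ =>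
    ⟨⟨h1, h5, ha⟩, hK, (DiCograph.noC4_un_iff ha (ha.isTransitive h1 h5)).2 h12, hP⟩
  tfae_have 7 → 9 := fun ⟨⟨h1, h5, h12, ha⟩, hT⟩ =>
    ⟨⟨h1, h5, h12, (DiCograph.noTwoK2_un_iff ha).1 hT.noTwoK2, ha⟩, hT.isCograph⟩
  tfae_have 9 → 8 := fun ⟨h, hT⟩ => ⟨h, hT.noP4⟩
  tfae_have 8 → 3 := fun ⟨⟨h1, h5, h12, h2, ha⟩, hP⟩ =>
    ⟨h1, h5, (DiCograph.noP4_un_iff ha (ha.isTransitive h1 h5)).1 hP, h12, h2, ha⟩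
  tfae_have 3 → 10 := fun ⟨h1, h5, h8, h12, h2, ha⟩ =>
    ⟨ha.isTransitive h1 h5, h8, h12, h2, ha⟩
  tfae_have 10 → 1 := fun ⟨ht, h8, h12, h2, ha⟩ =>
    DiCograph.isOrientedThreshold_of_free ha ht ((DiCograph.noP4_un_iff ha ht).2 h8)
      ((DiCograph.noC4_un_iff ha ht).2 h12) ((DiCograph.noTwoK2_un_iff ha).2 h2)
  tfae_finish
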